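/- A symmetric Friends Appreciation instance consists of a finite set of agents $\mathcal N=\{1,\dots,n\}$ and, for each agent $i$, a set of friends $F_i\subseteq\mathcal N\setminus\{i\}$ such that $i\in F_j$ if and only if $j\in F_i$. Given a partition $\pi$ of $\mathcal N$ into coalitions, let $\pi(i)$ be the coalition containing $i$. The utility of $i$ is $$u_i(\pi)=|\pi(i)\cap F_i|-\tfrac1n\,\bigl|\pi(i)\setminus(F_i\cup\{i\})\bigr|,$$ that is, each friend in the coalition of $i$ contributes $1$ and each other agent in it (an enemy) contributes $-\frac1n$. The egalitarian welfare of $\pi$ is $\mathsf{ESW}(\pi)=\min_{i\in\mathcal N}u_i(\pi)$, and $\mathsf{opt}=\max_\pi\mathsf{ESW}(\pi)$, the maximum being over all partitions of $\mathcal N$. Theorem. There is a deterministic algorithm, running in time polynomial in $n$, that, given any symmetric Friends Appreciation instance with $n$ agents (as the adjacency matrix of its friendship graph), outputs a partition $\pi$ of the agents that is a $\left(2-\frac{4}{n+2}\right)$-approximation to the maximum egalitarian welfare, i.e. $$\mathsf{opt}\le\left(2-\frac{4}{n+2}\right)\mathsf{ESW}(\pi).$$ (Polynomial time is understood on a random access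 machine whose arithmetic is addition and truncated subtraction of natural numbers at unit cost, a model polynomially equivalent to Turing machines.) -/

import Mathlib

/-! ### Hedonic games with friends and enemies, under Friends Appreciation -/

namespace FriendsGame

/-- A game with friends and enemies on the agents `Fin n`: every agent `i` has a set of friends
among the other agents; all remaining agents are enemies of `i`. -/
structure Instance (n : ℕ) where
  friends : Fin n → Finset (Fin n)
  self_notMem : ∀ i, i ∉ friends i

namespace Instance

variable {n : ℕ}

/-- Friendship is mutual. -/
def IsSymmetric (I : Instance n) : Prop :=
  ∀ i j : Fin n, i ∈ I.friends j ↔ j ∈ I.friends i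

/-- The value that `i` assigns to another agent `j` under Friends Appreciation:
`1` for a friend and `-1/n` for an enemy. -/
noncomputable def value (I : Instance n) (i j : Fin n) : ℝ :=
  if j ∈ I.friends i then 1 else -(1 / (n : ℝ))

/-- The utility of agent `i` in the coalition structure `π`: the sum of the values of the other
members of her coalition. -/
noncomputable def utility (I : Instance n) (π : Finpartition (Finset.univ : Finset (Fin n)))
    (i : Fin n) : ℝ :=
  ∑ j ∈ (π.part i).erase i, I.value i j

/-- The egalitarian welfare: the minimum of the utilities of the agents
(a minimum over a finite set; for `n = 0` it is `0` by convention). -/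
noncomputable def esw (I : Instance n) (π : Finpartition (Finset.univ : Finset (Fin n))) : ℝ :=
  ⨅ i : Fin n, I.utility π i

/-- The maximum egalitarian welfare over the (finitely many) coalition structures. -/
noncomputable def opt (I : Instance n) : ℝ :=
  ⨆ π : Finpartition (Finset.univ : Finset (Fin n)), I.esw π

/-- `π` is an `r`-approximation to the maximum egalitarian welfare. -/
def IsApprox (I : Instance n) (r : ℝ) (π : Finpartition (Finset.univ : Finset (Fin n))) : Prop :=
  I.opt ≤ r * I.esw π

end Instance

end FriendsGame

/-! ### A machine model with a step count

Structured programs for a random access machine over natural numbers. The only arithmetic is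
addition and truncated subtraction, and every elementary operation costs one step; in `t` steps
a number can grow by at most `O(t)` bits, so this model is polynomially equivalent to Turing
machines. -/

namespace RAM

/-- A memory: natural-number variables `x₀, x₁, …` and arrays `a₀, a₁, …` of natural numbers. -/
structure Mem where
  var : ℕ → ℕ
  arr : ℕ → ℕ → ℕ

/-- Expressions: constants, variables, array cells, sum and truncated difference. -/
inductive Expr where
  | lit (c : ℕ)
  | var (x : ℕ)
  | cell (a : ℕ) (i : Expr)
  | add (e₁ e₂ : Expr)
  | sub (e₁ e₂ : Expr)

namespace Expr

/-- The value of an expression. -/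
def eval (m : Mem) : Expr → ℕ
  | lit c => c
  | var x => m.var x
  | cell a i => m.arr a (i.eval m)
  | add e₁ e₂ => e₁.eval m + e₂.eval m
  | sub e₁ e₂ => e₁.eval m - e₂.eval m

/-- The number of steps that it takes to evaluate an expression. -/
def cost : Expr → ℕ
  | lit _ => 1
  | var _ => 1
  | cell _ i => i.cost + 1
  | add e₁ e₂ => e₁.cost + e₂.cost + 1
  | sub e₁ e₂ => e₁.cost + e₂.cost + 1

end Expr

/-- Programs. Tests succeed when the expression is nonzero. -/
inductive Prog where
  | skip
  | assign (x : ℕ) (e : Expr)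
  | store (a : ℕ) (i e : Expr)
  | seq (p q : Prog)
  | cond (e : Expr) (p q : Prog)
  | loop (e : Expr) (p : Prog)

/-- Assign the value `v` to the variable `x`. -/
def Mem.setVar (m : Mem) (x v : ℕ) : Mem :=
  { m with var := Function.update m.var x v }

/-- Write the value `v` into the cell `i` of the array `a`. -/
def Mem.setCell (m : Mem) (a i v : ℕ) : Mem :=
  { m with arr := Function.update m.arr a (Function.update (m.arr a) i v) }

/-- `Exec p m t m'`: the program `p`, started in the memory `m`, terminates after exactly `t` steps
in the memory `m'`. -/
inductive Exec : Prog → Mem → ℕ → Mem → Prop where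
  | skip (m : Mem) : Exec .skip m 1 m
  | assign (m : Mem) (x : ℕ) (e : Expr) :
      Exec (.assign x e) m (e.cost + 1) (m.setVar x (e.eval m))
  | store (m : Mem) (a : ℕ) (i e : Expr) :
      Exec (.store a i e) m (i.cost + e.cost + 1) (m.setCell a (i.eval m) (e.eval m))
  | seq {p q : Prog} {m m₁ m₂ : Mem} {t₁ t₂ : ℕ} :
      Exec p m t₁ m₁ → Exec q m₁ t₂ m₂ → Exec (.seq p q) m (t₁ + t₂) m₂
  | condTrue {e : Expr} {p q : Prog} {m m' : Mem} {t : ℕ} :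
      e.eval m ≠ 0 → Exec p m t m' → Exec (.cond e p q) m (e.cost + 1 + t) m'
  | condFalse {e : Expr} {p q : Prog} {m m' : Mem} {t : ℕ} :
      e.eval m = 0 → Exec q m t m' → Exec (.cond e p q) m (e.cost + 1 + t) m'
  | loopTrue {e : Expr} {p : Prog} {m m₁ m₂ : Mem} {t₁ t₂ : ℕ} :
      e.eval m ≠ 0 → Exec p m t₁ m₁ → Exec (.loop e p) m₁ t₂ m₂ →
      Exec (.loop e p) m (e.cost + 1 + t₁ + t₂) m₂
  | loopFalse {e : Expr} {p : Prog} {m : Mem} :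
      e.eval m = 0 → Exec (.loop e p) m (e.cost + 1) m

/-- Programs are deterministic: the running time and the result are determined by the input. -/
theorem Exec.unique {p : Prog} {m m₁ m₂ : Mem} {t₁ t₂ : ℕ}
    (h₁ : Exec p m t₁ m₁) (h₂ : Exec p m t₂ m₂) : t₁ = t₂ ∧ m₁ = m₂ := by
  induction h₁ generalizing t₂ m₂ with
  | skip | assign | store => cases h₂; exact ⟨rfl, rfl⟩
  | seq _ _ ih ih' =>
    cases h₂ with
    | seq a b =>
      obtain ⟨rfl, rfl⟩ := ih a
      obtain ⟨rfl, rfl⟩ := ih' b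
      exact ⟨rfl, rfl⟩
  | condTrue h _ ih =>
    cases h₂ with
    | condTrue _ a => obtain ⟨rfl, rfl⟩ := ih a; exact ⟨rfl, rfl⟩
    | condFalse h' _ => exact absurd h' h
  | condFalse h _ ih =>
    cases h₂ with
    | condTrue h' _ => exact absurd h h'
    | condFalse _ a => obtain ⟨rfl, rfl⟩ := ih a; exact ⟨rfl, rfl⟩
  | loopTrue h _ _ ih ih' =>
    cases h₂ with
    | loopTrue _ a b =>
      obtain ⟨rfl, rfl⟩ := ih a
      obtain ⟨rfl, rfl⟩ := ih' b
      exact ⟨rfl, rfl⟩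
    | loopFalse h' => exact absurd h' h
  | loopFalse h =>
    cases h₂ with
    | loopTrue h' _ _ => exact absurd h h'
    | loopFalse _ => exact ⟨rfl, rfl⟩

end RAM

namespace FriendsGame

open scoped Classical in
/-- The input of a program: the number of agents `n` in the variable `x₀`, and the `n × n` adjacency
matrix of the friendship graph, row by row, in the array `a₀`; everything else is `0`. -/
noncomputable def Instance.input {n : ℕ} (I : Instance n) : RAM.Mem where
  var x := if x = 0 then n else 0
  arr a k := if a = 0 ∧ ∃ i j : Fin n, k = (i : ℕ) * n + (j : ℕ) ∧ j ∈ I.friends i then 1 else 0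

open scoped Classical in
/-- The output of a program: the agents `i` and `j` are in the same coalition iff the cells `i`
and `j` of the array `a₁` hold the same number. -/
noncomputable def output (n : ℕ) (m : RAM.Mem) : Finpartition (Finset.univ : Finset (Fin n)) :=
  Finpartition.ofSetoid (Setoid.ker fun i : Fin n => m.arr 1 (i : ℕ))

end FriendsGame

/-!
If some agent has no friend, then `opt ≤ 0` and the singletons are optimal. If every agent has at
least two friends, the grand coalition is good enough, since `opt` is at most the smallest number of
friends. Otherwise some agent has exactly one friend, so `opt ≤ 1`, and the agents are packed into
stars. First every agent with one friend joins this friend, so that all leaves have degree one. Then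
every remaining agent has two friends, at most one of whom is the centre of a star with more than
`n / 2` agents, and joins the other one. If this friend is a leaf, it becomes the centre of a star
with at most three agents; there are at least four agents by then.

A star with at most `n / 2 + 1` agents gives each of them at least `(n + 2) / (2 * n)`, the inverse
of the ratio `2 - 4 / (n + 2)`. All leaves of a larger star have degree one. A partition that
separates one of them from the centre gives it at most `0`; any other partition has the whole star
in one coalition, where a leaf is no better off than in the star alone.
-/

/-! ### A program logic for total correctness with a time bound -/

namespace RAM

@[simp] theorem Mem.setVar_var (m : Mem) (x v y : ℕ) :
    (m.setVar x v).var y = if y = x then v else m.var y := by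
  simp [Mem.setVar, Function.update_apply]

@[simp] theorem Mem.setVar_arr (m : Mem) (x v : ℕ) : (m.setVar x v).arr = m.arr := rfl

@[simp] theorem Mem.setCell_var (m : Mem) (a i v : ℕ) : (m.setCell a i v).var = m.var := rfl

@[simp] theorem Mem.setCell_arr (m : Mem) (a i v b j : ℕ) :
    (m.setCell a i v).arr b j = if b = a ∧ j = i then v else m.arr b j := by
  by_cases h : b = a
  · subst h; simp [Mem.setCell, Function.update_apply]
  · simp [Mem.setCell, h]

namespace Expr

variable {m : Mem} {e f : Expr}

/-- The negation of a test. -/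
protected def not (e : Expr) : Expr := .sub (.lit 1) e

/-- The conjunction of two tests. -/
protected def and (e f : Expr) : Expr := .not (.add (.not e) (.not f))

/-- The test whether the value of `e` is at most the value of `f`. -/
protected def le (e f : Expr) : Expr := .sub (.add f (.lit 1)) e

theorem eval_not_ne_zero : (Expr.not e).eval m ≠ 0 ↔ e.eval m = 0 := by
  simp only [Expr.not, eval]; omega

theorem eval_and_ne_zero : (Expr.and e f).eval m ≠ 0 ↔ e.eval m ≠ 0 ∧ f.eval m ≠ 0 := by
  simp only [Expr.and, Expr.not, eval]; omega

theorem eval_le_ne_zero : (Expr.le e f).eval m ≠ 0 ↔ e.eval m ≤ f.eval m := by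
  simp only [Expr.le, eval]; omega

end Expr

namespace Prog

/-- The variables that a program may change. -/
@[simp] def vars : Prog → Finset ℕ
  | skip => ∅
  | assign x _ => {x}
  | store _ _ _ => ∅
  | seq p q => p.vars ∪ q.vars
  | cond _ p q => p.vars ∪ q.vars
  | loop _ p => p.vars

/-- The arrays that a program may change. -/
@[simp] def arrs : Prog → Finset ℕ
  | skip => ∅
  | assign _ _ => ∅
  | store a _ _ => {a}
  | seq p q => p.arrs ∪ q.arrs
  | cond _ p q => p.arrs ∪ q.arrs
  | loop _ p => p.arrs

/-- The memories `m` and `m'` differ at most in the variables and arrays that `p` may change. -/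
structure Frame (p : Prog) (m m' : Mem) : Prop where
  var : ∀ x ∉ p.vars, m'.var x = m.var x
  arr : ∀ a ∉ p.arrs, m'.arr a = m.arr a

variable {p q : Prog} {m m₁ m₂ : Mem}

theorem Frame.refl (p : Prog) (m : Mem) : p.Frame m m := ⟨fun _ _ => rfl, fun _ _ => rfl⟩

theorem Frame.trans (h₁ : p.Frame m m₁) (h₂ : p.Frame m₁ m₂) : p.Frame m m₂ :=
  ⟨fun x hx => (h₂.var x hx).trans (h₁.var x hx), fun a ha => (h₂.arr a ha).trans (h₁.arr a ha)⟩

theorem Frame.mono (h : p.Frame m m₁) (hv : p.vars ⊆ q.vars) (ha : p.arrs ⊆ q.arrs) :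
    q.Frame m m₁ :=
  ⟨fun x hx => h.var x fun hx' => hx (hv hx'), fun a ha' => h.arr a fun h' => ha' (ha h')⟩

theorem Frame.setVar (m : Mem) {x : ℕ} (hx : x ∈ p.vars) (v : ℕ) : p.Frame m (m.setVar x v) :=
  ⟨fun y hy => by simp [ne_of_mem_of_not_mem hx hy |>.symm], fun _ _ => rfl⟩

theorem Frame.of_exec {t : ℕ} (h : Exec p m t m₁) : p.Frame m m₁ := by
  induction h with
  | skip m => exact .refl _ m
  | assign m x e => exact .setVar m (by simp) _
  | store m a i e =>
    exact ⟨fun _ _ => rfl, fun b hb => by ext j; simp [show b ≠ a by simpa using hb]⟩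
  | seq _ _ ih₁ ih₂ =>
    exact (ih₁.mono Finset.subset_union_left Finset.subset_union_left).trans
      (ih₂.mono Finset.subset_union_right Finset.subset_union_right)
  | condTrue _ _ ih => exact ih.mono Finset.subset_union_left Finset.subset_union_left
  | condFalse _ _ ih => exact ih.mono Finset.subset_union_right Finset.subset_union_right
  | loopTrue _ _ _ ih₁ ih₂ => exact .trans ⟨ih₁.var, ih₁.arr⟩ ih₂
  | loopFalse => exact .refl _ _

open Polynomial in
/-- A bound for the running time of a program each of whose loops makes at most `X` rounds
whenever it is entered. -/
noncomputable def time : Prog → ℕ[X]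
  | skip => 1
  | assign _ e => C (e.cost + 1)
  | store _ i e => C (i.cost + e.cost + 1)
  | seq p q => p.time + q.time
  | cond e p q => C (e.cost + 1) + (p.time + q.time)
  | loop e p => C (e.cost + 1) + X * (C (e.cost + 1) + p.time)

/-- The weakest precondition for total correctness with a time bound: started in `m`, the program
`p` terminates within the time `p.time.eval n` in a memory that satisfies `Q`. -/
def WP (n : ℕ) (p : Prog) (Q : Mem → Prop) (m : Mem) : Prop :=
  ∃ t m', Exec p m t m' ∧ t ≤ p.time.eval n ∧ Q m'

namespace WP

variable {n x : ℕ} {e : Expr} {Q R : Mem → Prop}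

theorem mono_frame (h : WP n p Q m) (hQ : ∀ m', p.Frame m m' → Q m' → R m') : WP n p R m :=
  let ⟨t, m', hexec, ht, hm'⟩ := h
  ⟨t, m', hexec, ht, hQ m' (.of_exec hexec) hm'⟩

theorem mono (h : WP n p Q m) (hQ : ∀ m', Q m' → R m') : WP n p R m :=
  h.mono_frame fun m' _ => hQ m'

theorem skip (h : Q m) : WP n .skip Q m := ⟨_, _, .skip m, by simp [time], h⟩

theorem assign (h : Q (m.setVar x (e.eval m))) : WP n (.assign x e) Q m :=
  ⟨_, _, .assign m x e, by simp [time], h⟩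

theorem store {a : ℕ} {i : Expr} (h : Q (m.setCell a (i.eval m) (e.eval m))) :
    WP n (.store a i e) Q m :=
  ⟨_, _, .store m a i e, by simp [time], h⟩

theorem seq (h : WP n p (WP n q Q) m) : WP n (.seq p q) Q m := by
  obtain ⟨t₁, m₁, hp, ht₁, t₂, m₂, hq, ht₂, hm₂⟩ := h
  exact ⟨_, _, .seq hp hq, by simpa [time] using add_le_add ht₁ ht₂, hm₂⟩

theorem cond (hp : e.eval m ≠ 0 → WP n p Q m) (hq : e.eval m = 0 → WP n q Q m) :
    WP n (.cond e p q) Q m := by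
  by_cases he : e.eval m = 0
  · obtain ⟨t, m', hexec, ht, hm'⟩ := hq he
    exact ⟨_, _, .condFalse he hexec, by simp [time]; omega, hm'⟩
  · obtain ⟨t, m', hexec, ht, hm'⟩ := hp he
    exact ⟨_, _, .condTrue he hexec, by simp [time]; omega, hm'⟩

theorem loop (J : ℕ → Mem → Prop) (h₀ : J 0 m)
    (hstep : ∀ k < n, ∀ m, J k m → e.eval m ≠ 0 ∧ WP n p (J (k + 1)) m)
    (hend : ∀ m, J n m → e.eval m = 0) : WP n (.loop e p) (J n) m := by
  have hrounds : ∀ j k m, k + j = n → J k m → ∃ t m', Exec (.loop e p) m t m' ∧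
      t ≤ e.cost + 1 + j * (e.cost + 1 + p.time.eval n) ∧ J n m' := by
    intro j
    induction j with
    | zero =>
      rintro k m rfl hJ
      exact ⟨_, m, .loopFalse (hend m hJ), by simp, hJ⟩
    | succ j ih =>
      intro k m hk hJ
      obtain ⟨he, t₁, m₁, hp, ht₁, hJ₁⟩ := hstep k (by omega) m hJ
      obtain ⟨t₂, m₂, hloop, ht₂, hJ₂⟩ := ih (k + 1) m₁ (by omega) hJ₁
      exact ⟨_, m₂, .loopTrue he hp hloop, by rw [add_mul]; omega, hJ₂⟩
  obtain ⟨t, m', hexec, ht, hJ⟩ := hrounds n 0 m (zero_add n) h₀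
  exact ⟨t, m', hexec, by simpa [time] using ht, hJ⟩

end WP

/-- Run `p` with the variable `x` taking the values `0, 1, …`, below the value of the
variable `0`. -/
def forTo (x : ℕ) (p : Prog) : Prog :=
  .seq (.assign x (.lit 0)) (.loop (.sub (.var 0) (.var x))
    (.seq p (.assign x (.add (.var x) (.lit 1)))))

@[simp] theorem vars_forTo (x : ℕ) (p : Prog) : (forTo x p).vars = insert x p.vars := by
  ext y; simp [forTo]

@[simp] theorem arrs_forTo (x : ℕ) (p : Prog) : (forTo x p).arrs = p.arrs := by
  simp [forTo]

theorem WP.forTo {n x : ℕ} (hn : m.var 0 = n) (h0 : 0 ∉ (forTo x p).vars) (hx : x ∉ p.vars)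
    (J : ℕ → Mem → Prop) (hJ : ∀ k m v, J k m → J k (m.setVar x v)) (h₀ : J 0 m)
    (hstep : ∀ k < n, ∀ m', (forTo x p).Frame m m' → m'.var x = k → J k m' →
      WP n p (J (k + 1)) m') :
    WP n (forTo x p) (J n) m := by
  refine .seq (.assign (.mono (Q := fun m' => (Prog.forTo x p).Frame m m' ∧ m'.var x = n ∧ J n m')
    (.loop (fun k m' => (Prog.forTo x p).Frame m m' ∧ m'.var x = k ∧ J k m') ?_ ?_ ?_)
    fun _ h => h.2.2))
  · exact ⟨.setVar m (by simp) _, by simp [Expr.eval], hJ _ _ _ h₀⟩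
  · rintro k hk m₁ ⟨hframe, hxk, hJk⟩
    have hn₁ : m₁.var 0 = n := (hframe.var 0 h0).trans hn
    refine ⟨by simp only [Expr.eval, hn₁, hxk]; omega, .seq ?_⟩
    refine (hstep k hk m₁ hframe hxk hJk).mono_frame fun m₂ hp hJk₁ => .assign ⟨?_, ?_, ?_⟩
    · exact (hframe.trans (hp.mono (by simp) (by simp))).trans (.setVar m₂ (by simp) _)
    · simp [Expr.eval, hp.var x hx, hxk]
    · exact hJ _ _ _ hJk₁
  · rintro m₁ ⟨hframe, hxn, -⟩
    simp [Expr.eval, hframe.var 0 h0, hn, hxn]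

/-- Run `p` for the rows `0, 1, …` of a square matrix whose size is in the variable `0`, with the
row in the variable `1` and its offset in the variable `3`. -/
def forRows (p : Prog) : Prog :=
  .seq (.assign 3 (.lit 0)) (forTo 1 (.seq p (.assign 3 (.add (.var 3) (.var 0)))))

@[simp] theorem vars_forRows (p : Prog) : (forRows p).vars = insert 3 (insert 1 p.vars) := by
  ext y; simp [forRows]; tauto

@[simp] theorem arrs_forRows (p : Prog) : (forRows p).arrs = p.arrs := by
  simp [forRows]

theorem WP.forRows {n : ℕ} (hn : m.var 0 = n) (hvars : ∀ x ∈ ({0, 1, 3} : Finset ℕ), x ∉ p.vars)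
    (J : ℕ → (ℕ → ℕ → ℕ) → Prop) (h₀ : J 0 m.arr)
    (hstep : ∀ k < n, ∀ m', (forRows p).Frame m m' → m'.var 1 = k → m'.var 3 = k * n →
      J k m'.arr → WP n p (fun m'' => J (k + 1) m''.arr) m') :
    WP n (forRows p) (fun m' => J n m'.arr) m := by
  have h0 : 0 ∉ p.vars := hvars 0 (by simp)
  have h1 : 1 ∉ p.vars := hvars 1 (by simp)
  have h3 : 3 ∉ p.vars := hvars 3 (by simp)
  refine .seq (.assign (.mono (.forTo (by simpa using hn) (by simpa using h0) (by simpa using h1)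
    (fun k m' => m'.var 3 = k * n ∧ J k m'.arr) ?_ ?_ ?_) fun _ h => h.2))
  · exact fun k m' v h => by simpa using h
  · exact ⟨by simp [Expr.eval], h₀⟩
  · rintro k hk m₁ hframe hvar1 ⟨hvar3, hJk⟩
    have hframe' : (Prog.forRows p).Frame m m₁ :=
      (Frame.setVar m (by simp) 0).trans (hframe.mono (by simp [Prog.forRows]) (by simp))
    have hn₁ : m₁.var 0 = n := (hframe'.var 0 (by simpa using h0)).trans hn
    refine .seq ((hstep k hk m₁ hframe' hvar1 hvar3 hJk).mono_frame
      fun m₂ hp hJk₁ => .assign ⟨?_, hJk₁⟩)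
    simp [Expr.eval, hp.var 0 h0, hp.var 3 h3, hvar3, hn₁, add_mul]

end Prog

end RAM

namespace FriendsGame

open scoped Finset

/-! ### Star packings -/

section Stars

theorem eq_of_degree_le_one {V : Type*} {G : SimpleGraph V} {u v w : V}
    [Fintype (G.neighborSet u)] (hu : G.degree u ≤ 1) (hv : G.Adj u v) (hw : G.Adj u w) : v = w :=
  Finset.card_le_one.1 hu v (by simpa using hv) w (by simpa using hw)

theorem four_le_card_of_two_le_degree {V : Type*} [Fintype V] {G : SimpleGraph V} {u v : V}
    [Fintype (G.neighborSet u)] (hu : 2 ≤ G.degree u) (hne : u ≠ v) (huv : ¬ G.Adj u v) :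
    4 ≤ Fintype.card V := by
  classical
  have hcard : #(insert u (insert v (G.neighborFinset u))) = G.degree u + 2 := by
    rw [Finset.card_insert_of_notMem (by simp [hne]), Finset.card_insert_of_notMem (by simp [huv]),
      SimpleGraph.card_neighborFinset_eq_degree]
  have := Finset.card_le_univ (insert u (insert v (G.neighborFinset u)))
  omega

variable {V : Type*} [Fintype V] [DecidableEq V] {c : V → Option V} {u v w z : V}

/-- The star with centre `w` of a partial partition into stars, which is given by the map `c` from
every vertex to the centre of its star, or to `none` if the vertex is in no star. -/
def star (c : V → Option V) (w : V) : Finset V :=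
  {z | c z = some w}

@[simp] theorem mem_star : z ∈ star c w ↔ c z = some w := by
  simp [star]

theorem star_update (c : V → Option V) (v w w' : V) :
    star (Function.update c v (some w)) w' =
      if w' = w then insert v (star c w') else (star c w').erase v := by
  ext z
  split_ifs with hw
  · by_cases hz : z = v <;> simp [hz, hw]
  · by_cases hz : z = v <;> simp [hz, Ne.symm hw]

theorem disjoint_star (c : V → Option V) (hvw : v ≠ w) : Disjoint (star c v) (star c w) :=
  Finset.disjoint_left.2 fun _ hv hw =>
    hvw (Option.some.inj ((mem_star.1 hv).symm.trans (mem_star.1 hw)))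

/-- Put `u` into a star with centre `v`, making `v` a centre first: if `v` is a leaf of another
star, it leaves that star, and takes the centre with it if no other leaf is left. -/
def join (c : V → Option V) (u v z : V) : Option V :=
  if z = u ∨ z = v ∨ (c v = some z ∧ #(star c z) ≤ 2) then some v else c z

theorem join_apply_left (c : V → Option V) (u v : V) : join c u v u = some v := by
  simp [join]

theorem join_apply_right (c : V → Option V) (u v : V) : join c u v v = some v := by
  simp [join]

theorem join_ne_none (u v : V) (hz : c z ≠ none) : join c u v z ≠ none := by
  rw [join]
  split_ifs
  exacts [Option.some_ne_none v, hz]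

theorem join_eq_some_iff_of_ne (hw : w ≠ v) :
    join c u v z = some w ↔
      ¬ (z = u ∨ z = v ∨ (c v = some z ∧ #(star c z) ≤ 2)) ∧ c z = some w := by
  rw [join]
  split_ifs with h <;> simp [h, hw.symm]

theorem star_join_subset (hw : w ≠ v) : star (join c u v) w ⊆ star c w := fun z hz => by
  rw [mem_star] at hz ⊢
  exact ((join_eq_some_iff_of_ne hw).1 hz).2

variable {G : SimpleGraph V}

/-- `c` describes disjoint stars of the graph `G`, none of them a single vertex. -/
structure IsStarPacking (G : SimpleGraph V) (c : V → Option V) : Prop where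
  center {z w : V} : c z = some w → c w = some w
  adj {z w : V} : c z = some w → z ≠ w → G.Adj z w
  two_le_card {w : V} : c w = some w → 2 ≤ #(star c w)

namespace IsStarPacking

theorem of_forall_eq_none (hc : ∀ z, c z = none) : IsStarPacking G c := by
  constructor <;> simp [hc]

theorem exists_adj_mem_star (hc : IsStarPacking G c) (hz : c z = some w) :
    ∃ x ∈ star c w, G.Adj z x := by
  by_cases hzw : z = w
  · subst hzw
    obtain ⟨x, hx, hxz⟩ := Finset.exists_mem_ne (hc.two_le_card hz) z
    exact ⟨x, hx, (hc.adj (mem_star.1 hx) hxz).symm⟩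
  · exact ⟨w, mem_star.2 (hc.center hz), hc.adj hz hzw⟩

theorem star_eq_pair (hc : IsStarPacking G c) (hz : c z = some w) (hzw : z ≠ w)
    (hcard : #(star c w) ≤ 2) : star c w = {w, z} := by
  refine (Finset.eq_of_subset_of_card_le ?_ (hcard.trans_eq (Finset.card_pair hzw.symm).symm)).symm
  simp [Finset.insert_subset_iff, hz, hc.center hz]

theorem star_join_of_ne (hc : IsStarPacking G c) (hu : c u = none) (hw : w ≠ v) :
    star (join c u v) w = if c v = some w ∧ #(star c w) ≤ 2 then ∅ else (star c w).erase v := by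
  ext z
  rw [mem_star, join_eq_some_iff_of_ne hw]
  split_ifs with hvw
  · simp only [Finset.notMem_empty, iff_false, not_and]
    intro hstay hz
    rw [← mem_star, hc.star_eq_pair hvw.1 hw.symm hvw.2, Finset.mem_insert,
      Finset.mem_singleton] at hz
    rcases hz with rfl | rfl
    · exact hstay (Or.inr (Or.inr hvw))
    · exact hstay (Or.inr (Or.inl rfl))
  · have hzu : c z = some w → z ≠ u := by rintro hz rfl; simp [hu] at hz
    have hzw : c v = some z → c z = some w → z = w := fun hvz hz =>
      Option.some.inj ((hc.center hvz).symm.trans hz)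
    simp only [Finset.mem_erase, mem_star]
    aesop

theorem two_le_card_star_join (hc : IsStarPacking G c) (hu : c u = none) (huv : u ≠ v)
    (hw : join c u v w = some w) : 2 ≤ #(star (join c u v) w) := by
  by_cases hwv : w = v
  · subst hwv
    exact Finset.one_lt_card.2 ⟨u, mem_star.2 (join_apply_left c u w), w, mem_star.2 hw, huv⟩
  · rw [← mem_star, hc.star_join_of_ne hu hwv] at hw
    rw [hc.star_join_of_ne hu hwv]
    split_ifs at hw ⊢ with hdissolved
    · simp at hw
    · have hw₂ := hc.two_le_card (mem_star.1 (Finset.mem_of_mem_erase hw))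
      by_cases hv : c v = some w
      · rw [Finset.card_erase_of_mem (mem_star.2 hv)]
        have : ¬ #(star c w) ≤ 2 := fun h => hdissolved ⟨hv, h⟩
        omega
      · rwa [Finset.erase_eq_of_notMem (by simpa using hv)]

theorem join (hc : IsStarPacking G c) (hu : c u = none) (huv : G.Adj u v) :
    IsStarPacking G (join c u v) where
  center {z w} hz := by
    by_cases hwv : w = v
    · rw [hwv, join_apply_right]
    · rw [← mem_star, hc.star_join_of_ne hu hwv] at hz ⊢
      split_ifs at hz ⊢
      · simp at hz
      · simpa [hwv] using hc.center (mem_star.1 (Finset.mem_of_mem_erase hz))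
  adj {z w} hz hzw := by
    rw [FriendsGame.join] at hz
    split_ifs at hz with h
    · obtain rfl := Option.some.inj hz
      rcases h with rfl | rfl | ⟨hvz, -⟩
      · exact huv
      · exact absurd rfl hzw
      · exact (hc.adj hvz hzw.symm).symm
    · exact hc.adj hz hzw
  two_le_card := hc.two_le_card_star_join hu huv.ne

theorem two_mul_card_star_join_le (hc : IsStarPacking G c) (hV : 4 ≤ Fintype.card V)
    (hv : 2 * #(star c v) ≤ Fintype.card V) :
    2 * #(star (FriendsGame.join c u v) v) ≤ Fintype.card V + 2 := by
  by_cases hcv : c v = some v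
  · have hsub : star (FriendsGame.join c u v) v ⊆ insert u (star c v) := fun z hz => by
      rw [mem_star, FriendsGame.join] at hz
      grind [mem_star]
    have := (Finset.card_le_card hsub).trans (Finset.card_insert_le _ _)
    omega
  · have hsub : star (FriendsGame.join c u v) v ⊆ {u, v, (c v).getD v} := fun z hz => by
      have hzv : c z ≠ some v := fun h => hcv (hc.center h)
      rw [mem_star, FriendsGame.join] at hz
      grind
    have := (Finset.card_le_card hsub).trans Finset.card_le_three
    omega

end IsStarPacking

variable [DecidableRel G.Adj]

/-- The invariant of the first pass: every leaf of a star has degree at most one. -/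
def LeavesPendant (G : SimpleGraph V) [DecidableRel G.Adj] (c : V → Option V) : Prop :=
  ∀ z w, c z = some w → z ≠ w → G.degree z ≤ 1

/-- The invariant of the second pass: every star has at most `|V| / 2 + 1` vertices or only leaves
of degree at most one. -/
def IsBalanced (G : SimpleGraph V) [DecidableRel G.Adj] (c : V → Option V) : Prop :=
  ∀ z w, c z = some w → z ≠ w → G.degree z ≤ 1 ∨ 2 * #(star c w) ≤ Fintype.card V + 2

theorem exists_adj_two_mul_card_star_le (c : V → Option V) (hu : 2 ≤ G.degree u) :
    ∃ v, G.Adj u v ∧ 2 * #(star c v) ≤ Fintype.card V := by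
  obtain ⟨v, hv, w, hw, hvw⟩ := Finset.one_lt_card.1 hu
  rw [SimpleGraph.mem_neighborFinset] at hv hw
  have hsum : #(star c v) + #(star c w) ≤ Fintype.card V := by
    rw [← Finset.card_union_of_disjoint (disjoint_star c hvw)]
    exact Finset.card_le_univ _
  by_cases h : 2 * #(star c v) ≤ Fintype.card V
  · exact ⟨v, hv, h⟩
  · exact ⟨w, hw, by omega⟩

namespace IsStarPacking

theorem ne_none_of_adj (hc : IsStarPacking G c) (hv : G.degree v ≤ 1) (hcv : c v ≠ none)
    (huv : G.Adj v u) : c u ≠ none := by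
  obtain ⟨w, hw⟩ := Option.ne_none_iff_exists'.1 hcv
  obtain ⟨x, hx, hvx⟩ := hc.exists_adj_mem_star hw
  rw [eq_of_degree_le_one hv huv hvx, mem_star.1 hx]
  exact Option.some_ne_none w

theorem leavesPendant_join (hc : IsStarPacking G c) (hl : LeavesPendant G c) (hu : c u = none)
    (huv : G.Adj u v) (hdeg : G.degree u ≤ 1) : LeavesPendant G (FriendsGame.join c u v) := by
  intro z w hz hzw
  rw [FriendsGame.join] at hz
  split_ifs at hz with h
  · obtain rfl := Option.some.inj hz
    rcases h with rfl | rfl | ⟨hvz, -⟩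
    · exact hdeg
    · exact absurd rfl hzw
    · have hcv : c v ≠ none := by simp [hvz]
      exact absurd hu (hc.ne_none_of_adj (hl v z hvz hzw.symm) hcv huv.symm)
  · exact hl z w hz hzw

theorem isBalanced_join (hc : IsStarPacking G c) (hb : IsBalanced G c) (hV : 4 ≤ Fintype.card V)
    (hv : 2 * #(star c v) ≤ Fintype.card V) : IsBalanced G (FriendsGame.join c u v) := by
  intro z w hz hzw
  by_cases hwv : w = v
  · subst hwv
    exact Or.inr (hc.two_mul_card_star_join_le hV hv)
  · have hsub : star (FriendsGame.join c u v) w ⊆ star c w := star_join_subset hwv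
    have hcard := Finset.card_le_card hsub
    exact (hb z w (mem_star.1 (hsub (mem_star.2 hz))) hzw).imp_right (by omega)

theorem four_le_card (hc : IsStarPacking G c) (hv : G.degree v ≤ 1) (hcv : c v ≠ none)
    (hu : 2 ≤ G.degree u) (hcu : c u = none) : 4 ≤ Fintype.card V := by
  refine four_le_card_of_two_le_degree hu (v := v) (by rintro rfl; exact hcv hcu) fun huv => ?_
  exact hc.ne_none_of_adj hv hcv huv.symm hcu

end IsStarPacking

end Stars

/-! ### The programs -/

-- The programs loop over agents in the variables `1` and `2`, with the offset of the row in the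
-- variable `3`; the variable `4` is an accumulator or a flag, and `6`, `7`, `8` hold labels.

section Programs

open RAM RAM.Expr RAM.Prog

theorem join_eq_update_of_card_le {V : Type*} [Fintype V] [DecidableEq V] {c : V → Option V}
    (u : V) {v w : V} (hv : c v = some w) (hw : #(star c w) ≤ 2) :
    join c u v = Function.update (Function.update (Function.update c w (some v)) v (some v))
      u (some v) := by
  ext1 z
  simp only [join, hv, Function.update_apply, Option.some.injEq]
  grind

theorem join_eq_update_of_lt_card {V : Type*} [Fintype V] [DecidableEq V] {c : V → Option V}
    (u : V) {v : V} (hv : ∀ w, c v = some w → 2 < #(star c w)) :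
    join c u v = Function.update (Function.update c v (some v)) u (some v) := by
  ext1 z
  simp only [join, Function.update_apply]
  grind

variable {n : ℕ} {G : SimpleGraph (Fin n)} [DecidableRel G.Adj] {m m' : Mem} {p : Prog}
  {c : Fin n → Option (Fin n)} {u v w : Fin n}

/-- The number that stands for the centre of a star in the memory; `0` stands for no star. -/
def label : Option (Fin n) → ℕ
  | none => 0
  | some w => w + 1

theorem label_injective : Function.Injective (label (n := n)) := by
  rintro (_ | v) (_ | w) h <;> simp_all [label, Fin.val_inj]

/-- The arrays hold the partial partition `c` into stars: the array `1` the labels of the centres,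
the array `2` the size of each star at the label of its centre. -/
structure HoldsStars (c : Fin n → Option (Fin n)) (a : ℕ → ℕ → ℕ) : Prop where
  arr_one (i : Fin n) : a 1 i = label (c i)
  arr_two (w : Fin n) : a 2 (label (some w)) = #(star c w)

/-- The memory holds the number of vertices and the adjacency matrix of the graph `G`. -/
structure HoldsGraph (G : SimpleGraph (Fin n)) [DecidableRel G.Adj] (m : Mem) : Prop where
  var_zero : m.var 0 = n
  arr_zero (i j : Fin n) : m.arr 0 (i * n + j) = G.adjMatrix ℕ i j

/-- The memory holds the graph `G` and, in the array `3`, the degrees of its vertices. -/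
structure HoldsDegrees (G : SimpleGraph (Fin n)) [DecidableRel G.Adj] (m : Mem) : Prop
    extends HoldsGraph G m where
  arr_three (i : Fin n) : m.arr 3 i = G.degree i

theorem HoldsDegrees.of_frame (hm : HoldsDegrees G m) (hp : p.Frame m m') (hvar : 0 ∉ p.vars)
    (h₀ : 0 ∉ p.arrs) (h₃ : 3 ∉ p.arrs) : HoldsDegrees G m' where
  var_zero := (hp.var 0 hvar).trans hm.var_zero
  arr_zero := hp.arr 0 h₀ ▸ hm.arr_zero
  arr_three := hp.arr 3 h₃ ▸ hm.arr_three

/-- Store the sums of the rows of the matrix in the array `0` in the array `3`. -/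
def rowSums : Prog :=
  forRows (.seq (.assign 4 (lit 0)) (.seq
    (forTo 2 (.assign 4 (add (var 4) (cell 0 (add (var 3) (var 2))))))
    (.store 3 (var 1) (var 4))))

theorem wp_rowSums (hn : m.var 0 = n) :
    WP n rowSums (fun m' => ∀ i < n, m'.arr 3 i = ∑ j ∈ Finset.range n, m.arr 0 (i * n + j)) m := by
  refine .forRows hn (by simp)
    (fun k a => ∀ i < k, a 3 i = ∑ j ∈ Finset.range n, m.arr 0 (i * n + j)) (by simp) ?_
  refine fun k hk m₁ hframe hrow hoffset hsums => .seq (.assign (.seq ?_))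
  refine (WP.forTo (by simp [hframe.var 0, hn]) (by simp) (by simp)
    (fun j m' => m'.var 4 = ∑ v ∈ Finset.range j, m.arr 0 (k * n + v)) ?_ (by simp [Expr.eval])
    ?_).mono_frame fun m₂ hframe₂ hsum => .store fun i hi => ?_
  · exact fun j m' v h => by simpa using h
  · intro j _ m₂ hframe₂ hcol hsum
    refine .assign ?_
    simp [Finset.sum_range_succ, Expr.eval, hsum, hcol, hframe₂.var 3, hframe₂.arr 0,
      hframe.arr 0, hoffset]
  · have hrow₂ : m₂.var 1 = k := by simp [hframe₂.var 1, hrow]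
    rcases Nat.lt_succ_iff_lt_or_eq.1 hi with hik | rfl
    · simp [Expr.eval, hrow₂, hik.ne, hframe₂.arr 3, hsums i hik]
    · simp [Expr.eval, hrow₂, hsum]

theorem wp_rowSums_graph (hm : HoldsGraph G m) : WP n rowSums (HoldsDegrees G) m := by
  refine (wp_rowSums hm.var_zero).mono_frame fun m' hframe hsums =>
    ⟨⟨?_, fun i j => ?_⟩, fun i => ?_⟩
  · rw [hframe.var 0 (by simp [rowSums]), hm.var_zero]
  · rw [hframe.arr 0 (by simp [rowSums]), hm.arr_zero]
  · rw [hsums i i.2, ← Fin.sum_univ_eq_sum_range (fun j => m.arr 0 (i * n + j))]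
    simp only [hm.arr_zero, SimpleGraph.degree, SimpleGraph.neighborFinset_eq_filter,
      SimpleGraph.adjMatrix_apply, Finset.sum_boole, Nat.cast_id]

/-- Set the variable `4` to `1` if the test `g` succeeds for some value of the variable `1` below
that of the variable `0`, and to `0` otherwise. -/
def search (g : Expr) : Prog :=
  .seq (.assign 4 (lit 0)) (forTo 1 (.cond g (.assign 4 (lit 1)) .skip))

theorem wp_search {g : Expr} {T : Fin n → Prop} (hn : m.var 0 = n)
    (hg : ∀ (u : Fin n) m', (search g).Frame m m' → m'.var 1 = u → (g.eval m' ≠ 0 ↔ T u)) :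
    WP n (search g) (fun m' => m'.var 4 ≠ 0 ↔ ∃ u : Fin n, T u) m := by
  refine .seq (.assign (.mono (.forTo (by simpa using hn) (by simp) (by simp)
    (fun k m' => m'.var 4 ≠ 0 ↔ ∃ u : Fin n, u < k ∧ T u) ?_ (by simp [Expr.eval]) ?_)
    fun m' h => by simpa using h))
  · exact fun k m' v h => by simpa using h
  · intro k hk m₁ hframe hvar hfound
    have hT := hg ⟨k, hk⟩ m₁ ((Frame.setVar m (by simp [search]) _).trans
      (hframe.mono (by simp [search]) (by simp [search]))) hvar
    refine .cond (fun h => .assign ?_) fun h => .skip ?_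
    · simpa [Expr.eval] using ⟨⟨k, hk⟩, le_rfl, hT.1 h⟩
    · have hk : ¬ T ⟨k, hk⟩ := fun hk => hT.2 hk h
      rw [hfound]
      refine exists_congr fun u => and_congr_left fun hu => ?_
      have : (u : ℕ) ≠ k := by rintro rfl; exact hk hu
      omega

/-- The test whether the vertex in the variable `1` has degree at most `d`. -/
def degreeTest (d : ℕ) : Expr := .le (cell 3 (var 1)) (lit d)

theorem eval_degreeTest {d : ℕ} (hm : HoldsDegrees G m) (hu : m.var 1 = u) :
    (degreeTest d).eval m ≠ 0 ↔ G.degree u ≤ d := by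
  simp [degreeTest, eval_le_ne_zero, Expr.eval, hu, hm.arr_three, -ne_eq]

theorem wp_search_degreeTest {d : ℕ} (hm : HoldsDegrees G m) :
    WP n (search (degreeTest d)) (fun m' => HoldsDegrees G m' ∧ m'.arr = m.arr ∧
      (m'.var 4 ≠ 0 ↔ ∃ u, G.degree u ≤ d)) m := by
  have hkeep (m') (hframe : (search (degreeTest d)).Frame m m') : HoldsDegrees G m' :=
    hm.of_frame hframe (by simp [search]) (by simp [search]) (by simp [search])
  exact (wp_search hm.var_zero fun u m' hframe => eval_degreeTest (hkeep m' hframe)).mono_frame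
    fun m' hframe hfound =>
      ⟨hkeep m' hframe, funext fun a => hframe.arr a (by simp [search]), hfound⟩

/-- Move the vertex in the variable `x` to the star whose label is in the variable `7`. -/
def moveProg (x : ℕ) : Prog :=
  .seq (.assign 8 (cell 1 (var x)))
    (.seq (.store 2 (var 8) (sub (cell 2 (var 8)) (lit 1)))
      (.seq (.store 1 (var x) (var 7)) (.store 2 (var 7) (add (cell 2 (var 7)) (lit 1)))))

@[simp] theorem vars_moveProg (x : ℕ) : (moveProg x).vars = {8} := rfl

theorem wp_moveProg {x : ℕ} (hx : x ≠ 8) (hc : HoldsStars c m.arr) (hu : m.var x = u)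
    (hw : m.var 7 = label (some w)) :
    WP n (moveProg x) (fun m' => HoldsStars (Function.update c u (some w)) m'.arr) m := by
  refine .seq (.assign (.seq (.store (.seq (.store (.store ⟨fun z => ?_, fun z => ?_⟩))))))
  · by_cases hz : z = u
    · simp [Expr.eval, hx, hu, hw, hz]
    · simp [Expr.eval, hx, hu, hz, hc.arr_one, Fin.val_inj]
  · have hlabel : label (some z) = label (c u) ↔ u ∈ star c z := by
      rw [label_injective.eq_iff, mem_star, eq_comm]
    have hsize := hc.arr_two z
    suffices (if label (some z) = label (some w) then
          (if label (some w) = label (c u) then m.arr 2 (label (c u)) - 1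
            else m.arr 2 (label (some w))) + 1
        else if label (some z) = label (c u) then m.arr 2 (label (c u)) - 1
          else m.arr 2 (label (some z))) = #(star (Function.update c u (some w)) z) by
      simpa [Expr.eval, hx, hu, hw, hc.arr_one] using this
    rw [star_update]
    rcases eq_or_ne z w with rfl | hzw
    · by_cases hzu : u ∈ star c z
      · have hpos : 0 < #(star c z) := Finset.card_pos.2 ⟨u, hzu⟩
        rw [if_pos rfl, if_pos rfl, if_pos (hlabel.2 hzu), ← hlabel.2 hzu, hsize,
          Finset.insert_eq_of_mem hzu]
        omega
      · rw [if_pos rfl, if_pos rfl, if_neg (hlabel.not.2 hzu), hsize,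
          Finset.card_insert_of_notMem hzu]
    · rw [if_neg (label_injective.ne (by simpa using hzw)), if_neg hzw]
      by_cases hzu : u ∈ star c z
      · rw [if_pos (hlabel.2 hzu), ← hlabel.2 hzu, hsize, Finset.card_erase_of_mem hzu]
      · rw [if_neg (hlabel.not.2 hzu), hsize, Finset.erase_eq_of_notMem hzu]

/-- If the variable `6` holds the label of a star with at most two vertices, move its centre to
the star whose label is in the variable `7`. -/
def dissolveProg : Prog :=
  .cond (.and (var 6) (.le (cell 2 (var 6)) (lit 2)))
    (.seq (.assign 6 (sub (var 6) (lit 1))) (moveProg 6)) .skip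

@[simp] theorem vars_dissolveProg : dissolveProg.vars = {6, 8} := rfl

theorem wp_dissolveProg (hc : HoldsStars c m.arr) (hv : m.var 6 = label (c v))
    (hnew : m.var 7 = label (some v)) :
    WP n dissolveProg (fun m' => ∃ c', HoldsStars c' m'.arr ∧ ∀ u, join c u v =
      Function.update (Function.update c' v (some v)) u (some v)) m := by
  have htest : (Expr.and (var 6) (.le (cell 2 (var 6)) (lit 2))).eval m ≠ 0 ↔
      ∃ w, c v = some w ∧ #(star c w) ≤ 2 := by
    rw [eval_and_ne_zero, eval_le_ne_zero]
    simp only [Expr.eval, hv]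
    cases hcv : c v with
    | none => simp [label]
    | some w => rw [hc.arr_two]; simp [label]
  refine .cond (fun h => .seq (.assign ?_)) fun h => .skip ⟨c, hc, fun u => ?_⟩
  · obtain ⟨w, hw, hcard⟩ := htest.1 h
    refine (wp_moveProg (m := m.setVar 6 _) (u := w) (by simp) hc ?_ (by simpa using hnew)).mono
      fun m' hc' => ⟨_, hc', fun u => join_eq_update_of_card_le u hw hcard⟩
    simp [Expr.eval, hv, hw, label]
  · refine join_eq_update_of_lt_card u fun w hw => ?_
    by_contra! hcard
    exact htest.2 ⟨w, hw, hcard⟩ h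

/-- Replace the stars `c` by `join c u v`, where the variable `1` holds `u` and the variable `2`
holds `v`. -/
def joinProg : Prog :=
  .seq (.assign 6 (cell 1 (var 2))) (.seq (.assign 7 (add (var 2) (lit 1)))
    (.seq dissolveProg (.seq (moveProg 2) (moveProg 1))))

@[simp] theorem vars_joinProg : joinProg.vars = {6, 7, 8} := by decide

@[simp] theorem arrs_joinProg : joinProg.arrs = {1, 2} := rfl

theorem wp_joinProg (hc : HoldsStars c m.arr) (hu : m.var 1 = u) (hv : m.var 2 = v) :
    WP n joinProg (fun m' => HoldsStars (join c u v) m'.arr) m := by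
  refine .seq (.assign (.seq (.assign (.seq ((wp_dissolveProg
    (m := (m.setVar 6 _).setVar 7 _) (v := v) hc ?_ ?_).mono_frame
      fun m₁ hframe₁ ⟨c', hc', hjoin⟩ => .seq ((wp_moveProg (u := v) (w := v) (by simp) hc' ?_
      ?_).mono_frame fun m₂ hframe₂ hc₂ => ?_))))))
  · simp [Expr.eval, hv, hc.arr_one]
  · simp [Expr.eval, hv, label]
  · simp [hframe₁.var 2, hv]
  · simp [hframe₁.var 7, hv, label, Expr.eval]
  · rw [hjoin]
    refine wp_moveProg (by simp) hc₂ ?_ ?_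
    · simp [hframe₂.var 1, hframe₁.var 1, hu]
    · simp [hframe₂.var 7, hframe₁.var 7, hv, label, Expr.eval]

/-- Join the vertex in the variable `1`, if it is in no star, to the first neighbour for which the
test `g` succeeds. -/
def rowProg (g : Expr) : Prog :=
  forTo 2 (.cond (.and (.not (cell 1 (var 1))) (.and (cell 0 (add (var 3) (var 2))) g))
    joinProg .skip)

@[simp] theorem vars_rowProg (g : Expr) : (rowProg g).vars = {2, 6, 7, 8} := by
  simp [rowProg]

@[simp] theorem arrs_rowProg (g : Expr) : (rowProg g).arrs = {1, 2} := rfl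

/-- The test `g` decides the relation `T` between the current stars, the vertex in the
variable `1`, and the vertex in the variable `2`. -/
def Decides (G : SimpleGraph (Fin n)) [DecidableRel G.Adj] (g : Expr)
    (T : (Fin n → Option (Fin n)) → Fin n → Fin n → Prop) : Prop :=
  ∀ (m : Mem) (c : Fin n → Option (Fin n)) (u v : Fin n), HoldsDegrees G m → HoldsStars c m.arr →
    m.var 1 = u → m.var 2 = v → (g.eval m ≠ 0 ↔ T c u v)

variable {g : Expr} {T : (Fin n → Option (Fin n)) → Fin n → Fin n → Prop}
  {P : (Fin n → Option (Fin n)) → Prop}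

theorem eval_rowProg_test (hg : Decides G g T) (hm : HoldsDegrees G m)
    (hc : HoldsStars c m.arr) (hu : m.var 1 = u) (hv : m.var 2 = v) (hoffset : m.var 3 = u * n) :
    (Expr.and (.not (cell 1 (var 1))) (.and (cell 0 (add (var 3) (var 2))) g)).eval m ≠ 0 ↔
      c u = none ∧ G.Adj u v ∧ T c u v := by
  have hlabel : label (c u) = 0 ↔ c u = none := label_injective.eq_iff (b := none)
  rw [eval_and_ne_zero, eval_not_ne_zero, eval_and_ne_zero, hg m c u v hm hc hu hv]
  simp [Expr.eval, hu, hv, hoffset, hc.arr_one, hm.arr_zero, hlabel]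

theorem wp_rowProg (hg : Decides G g T) (hm : HoldsDegrees G m) (hc : HoldsStars c m.arr)
    (hu : m.var 1 = u) (hoffset : m.var 3 = u * n) (hP : P c)
    (hjoin : ∀ c v, P c → c u = none → G.Adj u v → T c u v → P (join c u v)) :
    WP n (rowProg g) (fun m' => ∃ c, HoldsStars c m'.arr ∧ P c ∧
      (c u = none → ∀ v, G.Adj u v → ¬ T c u v)) m := by
  refine (WP.forTo (p := .cond _ _ _) hm.var_zero (by simp) (by simp)
    (fun j m' => ∃ c, HoldsStars c m'.arr ∧ P c ∧
      (c u = none → ∀ v : Fin n, v < j → G.Adj u v → ¬ T c u v)) (fun _ _ _ h => h)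
    ⟨c, hc, hP, by simp⟩ ?_).mono
      fun m' ⟨c, hc, hP, hrow⟩ => ⟨c, hc, hP, fun hcu v => hrow hcu v v.2⟩
  rintro j hj m₁ hframe hv ⟨c, hc, hP, hrow⟩
  have hu₁ : m₁.var 1 = u := (hframe.var 1 (by simp)).trans hu
  have htest := eval_rowProg_test hg (hm.of_frame hframe (by simp) (by simp) (by simp)) hc hu₁
    (v := ⟨j, hj⟩) hv ((hframe.var 3 (by simp)).trans hoffset)
  refine .cond (fun h => ?_) fun h => .skip ⟨c, hc, hP, fun hcu v hvj huv hT => ?_⟩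
  · obtain ⟨hcu, huv, hT⟩ := htest.1 h
    exact (wp_joinProg hc hu₁ hv).mono fun m₂ hc₂ => ⟨_, hc₂, hjoin c _ hP hcu huv hT,
      fun hnone => absurd hnone (by simp [join_apply_left])⟩
  · rcases Nat.lt_succ_iff_lt_or_eq.1 hvj with hvj | hvj
    · exact hrow hcu v hvj huv hT
    · obtain rfl : v = ⟨j, hj⟩ := Fin.ext hvj
      exact htest.2 ⟨hcu, huv, hT⟩ h

/-- Join every vertex that is in no star to the first neighbour for which the test `g` succeeds. -/
def passProg (g : Expr) : Prog := forRows (rowProg g)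

@[simp] theorem vars_passProg (g : Expr) : (passProg g).vars = {3, 1, 2, 6, 7, 8} := by
  simp [passProg]

@[simp] theorem arrs_passProg (g : Expr) : (passProg g).arrs = {1, 2} := rfl

theorem wp_passProg {D : Fin n → Prop} (hg : Decides G g T) (hm : HoldsDegrees G m)
    (hc : HoldsStars c m.arr) (hP : P c)
    (hjoin : ∀ c u v, P c → c u = none → G.Adj u v → T c u v → P (join c u v))
    (hD : ∀ c u, P c → c u = none → D u → ∃ v, G.Adj u v ∧ T c u v) :
    WP n (passProg g) (fun m' => ∃ c, HoldsStars c m'.arr ∧ P c ∧ ∀ u, D u → c u ≠ none) m := by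
  refine (WP.forRows hm.var_zero (by simp)
    (fun k a => ∃ c, HoldsStars c a ∧ P c ∧ ∀ u : Fin n, u < k → D u → c u ≠ none)
    ⟨c, hc, hP, by simp⟩ ?_).mono fun m' ⟨c, hc, hP, hcover⟩ => ⟨c, hc, hP, fun u => hcover u u.2⟩
  rintro k hk m₁ hframe hu hoffset ⟨c, hc, hP, hcover⟩
  have hm₁ : HoldsDegrees G m₁ := hm.of_frame hframe (by simp) (by simp) (by simp)
  refine (wp_rowProg (u := ⟨k, hk⟩) hg hm₁ hc hu hoffset
    (P := fun c => P c ∧ ∀ u : Fin n, u < k → D u → c u ≠ none) ⟨hP, hcover⟩ ?_).mono ?_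
  · exact fun c v ⟨hP, hcover⟩ hcu huv hT =>
      ⟨hjoin c _ v hP hcu huv hT, fun z hz hDz => join_ne_none _ v (hcover z hz hDz)⟩
  · rintro m₂ ⟨c, hc, ⟨hP, hcover⟩, hrow⟩
    refine ⟨c, hc, hP, fun u hu hDu hcu => ?_⟩
    rcases Nat.lt_succ_iff_lt_or_eq.1 hu with hu | hu
    · exact hcover u hu hDu hcu
    · obtain rfl : u = ⟨k, hk⟩ := Fin.ext hu
      obtain ⟨v, huv, hT⟩ := hD c _ hP hcu hDu
      exact hrow hcu v huv hT

/-- The test whether at most half of the vertices are in the star whose centre is the vertex in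
the variable `2`. -/
def sizeTest : Expr :=
  .le (add (cell 2 (add (var 2) (lit 1))) (cell 2 (add (var 2) (lit 1)))) (var 0)

theorem decides_sizeTest : Decides G sizeTest fun c _ v => 2 * #(star c v) ≤ n := by
  intro m c u v hm hc _ hv
  have hsize := hc.arr_two v
  rw [sizeTest, eval_le_ne_zero]
  simp only [label] at hsize
  simp [Expr.eval, hv, hsize, hm.var_zero, two_mul]

theorem wp_passProg_degreeTest (hdeg : ∀ u, 0 < G.degree u) (hm : HoldsDegrees G m)
    (hc : HoldsStars c m.arr) (hnone : ∀ u, c u = none) :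
    WP n (passProg (degreeTest 1)) (fun m' => ∃ c, HoldsStars c m'.arr ∧
      (IsStarPacking G c ∧ LeavesPendant G c) ∧ ∀ u, G.degree u ≤ 1 → c u ≠ none) m := by
  refine wp_passProg (T := fun _ u _ => G.degree u ≤ 1)
    (fun m c u v hm _ hu _ => eval_degreeTest hm hu) hm hc
    ⟨.of_forall_eq_none hnone, by simp [LeavesPendant, hnone]⟩ ?_ ?_
  · exact fun c u v ⟨hpack, hpendant⟩ hcu huv hu =>
      ⟨hpack.join hcu huv, hpack.leavesPendant_join hpendant hcu huv hu⟩
  · intro c u _ _ hu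
    obtain ⟨v, huv⟩ := (G.degree_pos_iff_exists_adj u).1 (hdeg u)
    exact ⟨v, huv, hu⟩

theorem wp_passProg_sizeTest (hm : HoldsDegrees G m) (hc : HoldsStars c m.arr)
    (hpack : IsStarPacking G c) (hbal : IsBalanced G c) (hw : G.degree w ≤ 1)
    (hcover : ∀ u, G.degree u ≤ 1 → c u ≠ none) :
    WP n (passProg sizeTest) (fun m' => ∃ c, HoldsStars c m'.arr ∧
      IsStarPacking G c ∧ IsBalanced G c ∧ ∀ u, c u ≠ none) m := by
  refine (wp_passProg (D := fun _ => True) (P := fun c => IsStarPacking G c ∧ IsBalanced G c ∧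
    ∀ u, G.degree u ≤ 1 → c u ≠ none) decides_sizeTest hm hc ⟨hpack, hbal, hcover⟩ ?_ ?_).mono ?_
  · rintro c u v ⟨hpack, hbal, hcover⟩ hcu huv hsize
    have hu : 2 ≤ G.degree u := by by_contra! h; exact hcover u (by omega) hcu
    have hcard := hpack.four_le_card hw (hcover w hw) hu hcu
    exact ⟨hpack.join hcu huv, hpack.isBalanced_join hbal hcard (by simpa using hsize),
      fun z hz => join_ne_none u v (hcover z hz)⟩
  · rintro c u ⟨-, -, hcover⟩ hcu -
    have hu : 2 ≤ G.degree u := by by_contra! h; exact hcover u (by omega) hcu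
    simpa using exists_adj_two_mul_card_star_le c hu
  · exact fun m' ⟨c, hc, ⟨hpack, hbal, _⟩, hcover⟩ =>
      ⟨c, hc, hpack, hbal, fun u => hcover u trivial⟩

theorem wp_passes (hdeg : ∀ u, 0 < G.degree u) (hm : HoldsDegrees G m)
    (hc : HoldsStars c m.arr) (hnone : ∀ u, c u = none) (hw : G.degree w ≤ 1) :
    WP n (.seq (passProg (degreeTest 1)) (passProg sizeTest)) (fun m' => ∃ c, HoldsStars c m'.arr ∧
      IsStarPacking G c ∧ IsBalanced G c ∧ ∀ u, c u ≠ none) m :=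
  .seq ((wp_passProg_degreeTest hdeg hm hc hnone).mono_frame
    fun _ hframe ⟨_, hc, ⟨hpack, hpendant⟩, hcover⟩ =>
      wp_passProg_sizeTest (hm.of_frame hframe (by simp) (by simp) (by simp)) hc hpack
        (fun z w hz hzw => Or.inl (hpendant z w hz hzw)) hw hcover)

/-- Put every vertex into a coalition of its own. -/
def singletonsProg : Prog := forTo 1 (.store 1 (var 1) (var 1))

theorem wp_singletonsProg (hn : m.var 0 = n) :
    WP n singletonsProg (fun m' => ∀ i < n, m'.arr 1 i = i) m := by
  refine .forTo hn (by simp) (by simp) (fun k m' => ∀ i < k, m'.arr 1 i = i)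
    (fun _ _ _ h => h) (by simp) fun k _ m₁ _ hvar hids => .store fun i hi => ?_
  rcases Nat.lt_succ_iff_lt_or_eq.1 hi with hik | rfl
  · simp [Expr.eval, hvar, hik.ne, hids i hik]
  · simp [Expr.eval, hvar]

/-- The approximation algorithm: singletons if some agent has no friend, the grand coalition if
all agents have two friends, and otherwise the stars that the two passes form. -/
def starProg : Prog :=
  .seq rowSums (.seq (search (degreeTest 0)) (.cond (var 4) singletonsProg
    (.seq (search (degreeTest 1)) (.cond (var 4)
      (.seq (passProg (degreeTest 1)) (passProg sizeTest)) .skip))))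

end Programs

/-! ### Utilities and approximation -/

namespace Instance

variable {n : ℕ} (I : Instance n) (π : Finpartition (Finset.univ : Finset (Fin n))) {i j : Fin n}

theorem utility_eq (i : Fin n) : I.utility π i =
    #(π.part i ∩ I.friends i) * (1 + 1 / (n : ℝ)) - (#(π.part i) - 1) / n := by
  have hi : i ∈ π.part i := π.mem_part (Finset.mem_univ i)
  have hvalue (j : Fin n) :
      I.value i j = (if j ∈ I.friends i then 1 + 1 / (n : ℝ) else 0) - 1 / n := by
    rw [value]; split_ifs <;> ring
  have hfriends : (π.part i).erase i ∩ I.friends i = π.part i ∩ I.friends i := by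
    rw [Finset.erase_inter, Finset.erase_eq_of_notMem (by simp [I.self_notMem])]
  simp only [utility, hvalue, Finset.sum_sub_distrib, Finset.sum_ite_mem, Finset.sum_const,
    hfriends, nsmul_eq_mul, Finset.card_erase_of_mem hi,
    Nat.cast_sub (Finset.card_pos.2 ⟨i, hi⟩ : 1 ≤ #(π.part i)), Nat.cast_one, mul_one_div]

theorem utility_le_card_inter (i : Fin n) : I.utility π i ≤ #(π.part i ∩ I.friends i) := by
  have hlt : #(π.part i ∩ I.friends i) < #(π.part i) := Finset.card_lt_card <|
    inf_lt_left.2 fun h => I.self_notMem i (h (π.mem_part (Finset.mem_univ i)))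
  have hle : (#(π.part i ∩ I.friends i) : ℝ) ≤ #(π.part i) - 1 :=
    le_sub_iff_add_le.2 (by exact_mod_cast hlt)
  calc I.utility π i
    _ = #(π.part i ∩ I.friends i) - (#(π.part i) - 1 - #(π.part i ∩ I.friends i)) / n := by
      rw [utility_eq]; ring
    _ ≤ #(π.part i ∩ I.friends i) := sub_le_self _ (div_nonneg (by linarith) (by positivity))

theorem utility_nonpos (h : Disjoint (π.part i) (I.friends i)) : I.utility π i ≤ 0 := by
  simpa [Finset.disjoint_iff_inter_eq_empty.1 h] using I.utility_le_card_inter π i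

theorem le_utility_of_mem_friends (hj : j ∈ π.part i) (hij : j ∈ I.friends i) :
    1 - (#(π.part i) - 2) / (n : ℝ) ≤ I.utility π i := by
  have hcard : (1 : ℝ) ≤ #(π.part i ∩ I.friends i) := by
    exact_mod_cast Finset.card_pos.2 ⟨j, Finset.mem_inter.2 ⟨hj, hij⟩⟩
  calc 1 - (#(π.part i) - 2) / (n : ℝ)
    _ = 1 * (1 + 1 / (n : ℝ)) - (#(π.part i) - 1) / n := by ring
    _ ≤ I.utility π i := by rw [utility_eq]; gcongr

theorem utility_le_of_card_friends_le_one (hi : #(I.friends i) ≤ 1) :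
    I.utility π i ≤ 1 - (#(π.part i) - 2) / (n : ℝ) := by
  have hcard : (#(π.part i ∩ I.friends i) : ℝ) ≤ 1 := by
    exact_mod_cast (Finset.card_le_card Finset.inter_subset_right).trans hi
  calc I.utility π i
    _ ≤ 1 * (1 + 1 / (n : ℝ)) - (#(π.part i) - 1) / n := by rw [utility_eq]; gcongr
    _ = 1 - (#(π.part i) - 2) / (n : ℝ) := by ring

theorem opt_le {a : ℝ} (h : ∀ π, ∃ i, I.utility π i ≤ a) : I.opt ≤ a :=
  ciSup_le fun π => let ⟨i, hi⟩ := h π; (ciInf_le (Set.finite_range _).bddBelow i).trans hi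

theorem opt_le_card_friends (i : Fin n) : I.opt ≤ #(I.friends i) :=
  I.opt_le fun π => ⟨i, (I.utility_le_card_inter π i).trans <| by
    exact_mod_cast Finset.card_le_card Finset.inter_subset_right⟩

theorem opt_le_of_friends_eq_singleton {S : Finset (Fin n)} {w : Fin n} (hS : 2 ≤ #S)
    (hleaf : ∀ j ∈ S, j ≠ w → I.friends j = {w}) : I.opt ≤ 1 - (#S - 2) / (n : ℝ) := by
  refine I.opt_le fun π => ?_
  have hw : w ∈ π.part w := π.mem_part (Finset.mem_univ w)
  by_cases hsub : S ⊆ π.part w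
  · obtain ⟨j, hj, hjw⟩ := Finset.exists_mem_ne hS w
    refine ⟨j, (I.utility_le_of_card_friends_le_one π (by simp [hleaf j hj hjw])).trans ?_⟩
    rw [π.part_eq_of_mem (π.part_mem.2 (Finset.mem_univ w)) (hsub hj)]
    gcongr
  · obtain ⟨j, hj, hjw⟩ := Finset.not_subset.1 hsub
    have hne : j ≠ w := by rintro rfl; exact hjw hw
    refine ⟨j, (I.utility_nonpos π ?_).trans ?_⟩
    · rw [hleaf j hj hne, Finset.disjoint_singleton_right]
      intro hwj
      rw [π.part_eq_of_mem (π.part_mem.2 (Finset.mem_univ j)) hwj] at hjw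
      exact hjw (π.mem_part (Finset.mem_univ j))
    · have hcard : (#S : ℝ) ≤ n := by simpa using Finset.card_le_univ S
      rw [sub_nonneg]
      exact div_le_one_of_le₀ (by linarith) (by positivity)

theorem isApprox_of_forall_utility {r : ℝ} (h : ∀ i, I.opt ≤ r * I.utility π i) :
    I.IsApprox r π := by
  rcases n.eq_zero_or_pos with rfl | hn
  · simp [IsApprox, opt, esw]
  · have : Nonempty (Fin n) := ⟨⟨0, hn⟩⟩
    obtain ⟨i, hi⟩ := exists_eq_ciInf_of_finite (f := I.utility π)
    rw [IsApprox, esw, ← hi]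
    exact h i

theorem isApprox_of_part_eq_singleton (r : ℝ) (hi : I.friends i = ∅)
    (hπ : ∀ j, π.part j = {j}) : I.IsApprox r π :=
  I.isApprox_of_forall_utility π fun j => by
    simpa [utility, hπ j, hi] using I.opt_le_card_friends i

theorem isApprox_of_part_eq_univ (hfriends : ∀ i, 2 ≤ #(I.friends i))
    (hπ : ∀ i, π.part i = Finset.univ) : I.IsApprox (2 - 4 / ((n : ℝ) + 2)) π := by
  refine I.isApprox_of_forall_utility π fun i => (I.opt_le_card_friends i).trans ?_
  have hdeg : (2 : ℝ) ≤ #(I.friends i) := by exact_mod_cast hfriends i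
  have hn : (0 : ℝ) < n := by exact_mod_cast i.pos
  have hratio : (2 - 4 / ((n : ℝ) + 2)) * I.utility π i =
      2 * (#(I.friends i) * (n + 1) - (n - 1)) / (n + 2) := by
    rw [utility_eq, hπ, Finset.univ_inter, Finset.card_univ, Fintype.card_fin]
    field_simp
    ring
  rw [hratio, le_div_iff₀ (by positivity)]
  nlinarith

theorem one_le_two_sub_four_div {x : ℝ} (hx : 2 ≤ x) : 1 ≤ 2 - 4 / (x + 2) := by
  have : 4 / (x + 2) ≤ 1 := (div_le_one (by positivity)).2 (by linarith)
  linarith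

theorem one_le_two_sub_four_div_mul {x s : ℝ} (hx : 0 < x) (hs : 2 * s ≤ x + 2) :
    1 ≤ (2 - 4 / (x + 2)) * (1 - (s - 2) / x) := by
  have hratio : (2 - 4 / (x + 2)) * (1 - (s - 2) / x) = 2 * (x + 2 - s) / (x + 2) := by
    field_simp
    ring
  rw [hratio, one_le_div (by positivity)]
  linarith

theorem isApprox_of_part_star (hi : #(I.friends i) ≤ 1)
    (hfriend : ∀ i, ∃ j ∈ π.part i, j ∈ I.friends i)
    (hpart : ∀ i, 2 * #(π.part i) ≤ n + 2 ∨ ∃ w, ∀ j ∈ π.part i, j ≠ w → I.friends j = {w}) :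
    I.IsApprox (2 - 4 / ((n : ℝ) + 2)) π := by
  refine I.isApprox_of_forall_utility π fun k => ?_
  obtain ⟨j, hj, hkj⟩ := hfriend k
  have hutility := I.le_utility_of_mem_friends π hj hkj
  have hcard : 2 ≤ #(π.part k) := Finset.one_lt_card.2 ⟨k, π.mem_part (Finset.mem_univ k), j, hj,
    by rintro rfl; exact I.self_notMem _ hkj⟩
  have hcard_le : #(π.part k) ≤ n := by simpa using Finset.card_le_univ (π.part k)
  have hn : (2 : ℝ) ≤ n := by exact_mod_cast hcard.trans hcard_le
  have hratio := one_le_two_sub_four_div hn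
  rcases hpart k with hsmall | ⟨w, hleaf⟩
  · calc I.opt
      _ ≤ 1 := (I.opt_le_card_friends i).trans (by exact_mod_cast hi)
      _ ≤ (2 - 4 / ((n : ℝ) + 2)) * (1 - (#(π.part k) - 2) / n) :=
        one_le_two_sub_four_div_mul (by linarith) (by exact_mod_cast hsmall)
      _ ≤ (2 - 4 / ((n : ℝ) + 2)) * I.utility π k := by gcongr
  · have hnonneg : 0 ≤ 1 - (#(π.part k) - 2) / (n : ℝ) := by
      have : (#(π.part k) : ℝ) ≤ n := by exact_mod_cast hcard_le
      exact sub_nonneg.2 (div_le_one_of_le₀ (by linarith) (by positivity))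
    calc I.opt
      _ ≤ 1 - (#(π.part k) - 2) / (n : ℝ) := I.opt_le_of_friends_eq_singleton hcard hleaf
      _ ≤ I.utility π k := hutility
      _ ≤ (2 - 4 / ((n : ℝ) + 2)) * I.utility π k :=
        le_mul_of_one_le_left (hnonneg.trans hutility) hratio

variable {I} {π}

/-- The friendship graph of a symmetric instance. -/
def graph (hI : I.IsSymmetric) : SimpleGraph (Fin n) where
  Adj i j := j ∈ I.friends i
  symm := ⟨fun i j h => (hI j i).1 h⟩
  loopless := ⟨I.self_notMem⟩

@[simp] theorem graph_adj (hI : I.IsSymmetric) : (graph hI).Adj i j ↔ j ∈ I.friends i := Iff.rfl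

instance (hI : I.IsSymmetric) : DecidableRel (graph hI).Adj :=
  fun i j => inferInstanceAs (Decidable (j ∈ I.friends i))

@[simp] theorem degree_graph (hI : I.IsSymmetric) (i : Fin n) :
    (graph hI).degree i = #(I.friends i) := by
  rw [SimpleGraph.degree]
  congr 1
  ext j
  simp

theorem isApprox_of_isStarPacking (hI : I.IsSymmetric) {c : Fin n → Option (Fin n)}
    (hc : IsStarPacking (graph hI) c) (hbal : IsBalanced (graph hI) c) (hcover : ∀ j, c j ≠ none)
    (hi : #(I.friends i) ≤ 1) (hπ : ∀ j k, k ∈ π.part j ↔ c k = c j) :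
    I.IsApprox (2 - 4 / ((n : ℝ) + 2)) π := by
  have hpart {j w : Fin n} (hj : c j = some w) : π.part j = star c w := by
    ext k; rw [hπ, hj, mem_star]
  refine I.isApprox_of_part_star π hi (fun j => ?_) fun j => ?_ <;>
    obtain ⟨w, hw⟩ := Option.ne_none_iff_exists'.1 (hcover j)
  · rw [hpart hw]
    exact hc.exists_adj_mem_star hw
  · rw [hpart hw, or_iff_not_imp_left]
    refine fun hlarge => ⟨w, fun k hk hkw => ?_⟩
    have hdeg : #(I.friends k) ≤ 1 := by
      simpa [hlarge] using hbal k w (mem_star.1 hk) hkw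
    have hadj : w ∈ I.friends k := hc.adj (mem_star.1 hk) hkw
    exact Finset.eq_singleton_iff_unique_mem.2
      ⟨hadj, fun z hz => Finset.card_le_one.1 hdeg z hz w hadj⟩

end Instance

section Correctness

open RAM RAM.Prog Instance

variable {n : ℕ} {I : Instance n} {m m' : Mem}

theorem mem_part_output (m : Mem) (i j : Fin n) :
    j ∈ (output n m).part i ↔ m.arr 1 j = m.arr 1 i := by
  classical
  rw [output, Finpartition.mem_part_ofSetoid_iff_rel, Setoid.ker_def, eq_comm]

theorem holdsGraph_input (hI : I.IsSymmetric) : HoldsGraph (graph hI) I.input where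
  var_zero := by simp [input]
  arr_zero i j := by
    have hindex (i' j' : Fin n) : (i * n + j : ℕ) = i' * n + j' ↔ i = i' ∧ j = j' := by
      refine ⟨fun h => ?_, by rintro ⟨rfl, rfl⟩; rfl⟩
      have hdiv := congrArg (· / n) h
      have hmod := congrArg (· % n) h
      simp only [mul_comm _ n, Nat.mul_add_div i.pos, Nat.mul_add_mod, Nat.div_eq_of_lt j.2,
        Nat.div_eq_of_lt j'.2, Nat.mod_eq_of_lt j.2, Nat.mod_eq_of_lt j'.2, add_zero] at hdiv hmod
      exact ⟨Fin.ext hdiv, Fin.ext hmod⟩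
    simp [input, hindex, SimpleGraph.adjMatrix_apply]

theorem isApprox_output_of_singletons (r : ℝ) {u : Fin n} (hu : I.friends u = ∅)
    (hm : ∀ i < n, m.arr 1 i = i) : I.IsApprox r (output n m) := by
  refine I.isApprox_of_part_eq_singleton _ r hu fun j => ?_
  ext k
  rw [mem_part_output, hm k k.2, hm j j.2, Fin.val_inj, Finset.mem_singleton]

theorem isApprox_output_of_grand (hfriends : ∀ i, 2 ≤ #(I.friends i))
    (hm : ∀ i : Fin n, m.arr 1 i = 0) : I.IsApprox (2 - 4 / ((n : ℝ) + 2)) (output n m) := by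
  refine I.isApprox_of_part_eq_univ _ hfriends fun j => ?_
  ext k
  simp [mem_part_output, hm]

theorem isApprox_output_of_stars (hI : I.IsSymmetric) {u : Fin n} (hu : #(I.friends u) ≤ 1)
    (hm : ∃ c, HoldsStars c m.arr ∧ IsStarPacking (graph hI) c ∧ IsBalanced (graph hI) c ∧
      ∀ j, c j ≠ none) : I.IsApprox (2 - 4 / ((n : ℝ) + 2)) (output n m) := by
  obtain ⟨c, hc, hpack, hbal, hcover⟩ := hm
  refine isApprox_of_isStarPacking hI hpack hbal hcover hu fun j k => ?_
  rw [mem_part_output, hc.arr_one, hc.arr_one, label_injective.eq_iff]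

theorem wp_starProg (hI : I.IsSymmetric) :
    WP n starProg (fun m => I.IsApprox (2 - 4 / ((n : ℝ) + 2)) (output n m)) I.input := by
  refine .seq ((wp_rowSums_graph (holdsGraph_input hI)).mono_frame fun m₁ hframe₁ hm₁ => .seq
    ((wp_search_degreeTest hm₁).mono fun m₂ ⟨hm₂, harr₂, hisolated⟩ => .cond (fun hflag => ?_)
      fun hflag => .seq ((wp_search_degreeTest hm₂).mono fun m₃ ⟨hm₃, harr₃, hpendant⟩ => ?_)))
  · obtain ⟨u, hu⟩ := hisolated.1 hflag
    exact (wp_singletonsProg hm₂.var_zero).mono fun m₃ =>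
      isApprox_output_of_singletons _ (by simpa using hu)
  have hzero : ∀ a, a = 1 ∨ a = 2 → m₃.arr a = fun _ => 0 := by
    rintro a (rfl | rfl) <;> ext <;> simp [harr₃, harr₂, hframe₁.arr, rowSums, input]
  have hdeg : ∀ u, 0 < (graph hI).degree u := fun u =>
    Nat.pos_of_ne_zero fun hu => hisolated.2 ⟨u, hu.le⟩ hflag
  refine .cond (fun hflag' => ?_) fun hflag' => .skip ?_
  · obtain ⟨u, hu⟩ := hpendant.1 hflag'
    refine (wp_passes (c := fun _ => none) hdeg hm₃ ⟨?_, ?_⟩ (fun _ => rfl) hu).mono fun m₄ =>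
      isApprox_output_of_stars hI (by simpa using hu)
    · simp [hzero, label]
    · simp [hzero, star]
  · refine isApprox_output_of_grand (fun u => ?_) (by simp [hzero])
    by_contra! hu
    exact hpendant.2 ⟨u, by simpa using Nat.le_of_lt_succ hu⟩ hflag'

end Correctness

end FriendsGame

theorem mainTheorem7 :
    ∃ (P : RAM.Prog) (p : Polynomial ℕ), ∀ (n : ℕ) (I : FriendsGame.Instance n), I.IsSymmetric →
      ∃ (t : ℕ) (m : RAM.Mem), RAM.Exec P I.input t m ∧ t ≤ p.eval n ∧
        I.IsApprox (2 - 4 / ((n : ℝ) + 2)) (FriendsGame.output n m) :=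
  ⟨FriendsGame.starProg, FriendsGame.starProg.time, fun _ _ hI => FriendsGame.wp_starProg hI⟩
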